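/- **Conventions.** Let $H^3=\{(z,t): z\in\mathbb C,\ t>0\}$ be hyperbolic $3$-space, with its distance $d$ of curvature $-1$, given by $\cosh d\big((z,t),(w,s)\big)=1+\frac{|z-w|^2+(t-s)^2}{2ts}$. Let $S=\mathbb C\cup\{\infty\}$ be the Riemann sphere, viewed as the ideal boundary of $H^3$; every isometry of $H^3$ extends continuously to a homeomorphism of $S$, so that groups of isometries of $H^3$ act on $S$. A *nice lattice* is a group $\Gamma$ of isometries of $H^3$ such that $H^3/\Gamma$ is a compact Hausdorff space and $H^3\to H^3/\Gamma$ is a covering map (that is, $H^3/\Gamma$ is a compact hyperbolic $3$-manifold with deck group $\Gamma$). A homeomorphism $h:S\to S$ is *equivariant* if there are nice lattices $\Gamma_1,\Gamma_2$ with $h\Gamma_1h^{-1}=\Gamma_2$ as groups acting on $S$. A *disk* is a round disk in $\mathbb C=\mathbb R^2$, open or closed, of positive radius. **Theorem (Disk).** Let $h:S\to S$ be an equivariant homeomorphism with $h(\infty)=\infty$. There is a constant $K$, depending only on $h$, such that for every disk $\Delta\subset\mathbb C$ there are disks $D_1,D_2\subset\mathbb C$ with $$D_1\subset h(\Delta)\subset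 D_2\qquad\text{and}\qquad \frac{\operatorname{diam}(D_2)}{\operatorname{diam}(D_1)}<K .$$ -/

import Mathlib

open Filter Topology

noncomputable section

/-- Points `(z, t)` of the upper half-space `ℂ × (0, ∞)`. -/
@[ext]
structure HypSpace where
  z : ℂ
  t : ℝ
  t_pos : 0 < t

namespace HypSpace

/-- The point as an element of the Euclidean space `ℂ × ℝ`. -/
def toEucl (p : HypSpace) : WithLp 2 (ℂ × ℝ) := WithLp.toLp 2 (p.z, p.t)

/-- The Euclidean mirror image in the plane `ℂ × {0}`. -/
def mirror (p : HypSpace) : WithLp 2 (ℂ × ℝ) := WithLp.toLp 2 (p.z, -p.t)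

/-- The hyperbolic distance of curvature `-1`:
`2 arsinh (|p - q| / (2 √(t s)))` for `p = (z, t)`, `q = (w, s)`, with `|p - q|` Euclidean. -/
instance : Dist HypSpace :=
  ⟨fun p q => 2 * Real.arsinh (dist p.toEucl q.toEucl / (2 * √(p.t * q.t)))⟩

theorem dist_def (p q : HypSpace) :
    dist p q = 2 * Real.arsinh (dist p.toEucl q.toEucl / (2 * √(p.t * q.t))) := rfl

theorem eucl_dist_sq (p q : HypSpace) :
    dist p.toEucl q.toEucl ^ 2 = dist p.z q.z ^ 2 + (p.t - q.t) ^ 2 := by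
  rw [WithLp.prod_dist_eq_of_L2, Real.sq_sqrt (by positivity), Real.dist_eq, sq_abs]
  rfl

theorem mirror_dist_sq (p q : HypSpace) :
    dist p.toEucl q.mirror ^ 2 = dist p.z q.z ^ 2 + (p.t + q.t) ^ 2 := by
  rw [WithLp.prod_dist_eq_of_L2, Real.sq_sqrt (by positivity), Real.dist_eq, sq_abs]
  simp [toEucl, mirror]

theorem sinh_half_dist (p q : HypSpace) :
    Real.sinh (dist p q / 2) = dist p.toEucl q.toEucl / (2 * √(p.t * q.t)) := by
  rw [dist_def, mul_div_cancel_left₀ _ (two_ne_zero' ℝ), Real.sinh_arsinh]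

/-- The usual formula `cosh d = 1 + (|z - w|² + (t - s)²) / (2 t s)`. -/
theorem cosh_dist (p q : HypSpace) :
    Real.cosh (dist p q) =
      1 + (dist p.z q.z ^ 2 + (p.t - q.t) ^ 2) / (2 * p.t * q.t) := by
  have hp := p.t_pos
  have hq := q.t_pos
  have h : dist p q = 2 * (dist p q / 2) := by ring
  rw [h, Real.cosh_two_mul, Real.cosh_sq, sinh_half_dist, div_pow, mul_pow,
    Real.sq_sqrt (by positivity), eucl_dist_sq]
  field_simp
  ring

theorem cosh_half_dist (p q : HypSpace) :
    Real.cosh (dist p q / 2) = dist p.toEucl q.mirror / (2 * √(p.t * q.t)) := by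
  have hp := p.t_pos
  have hq := q.t_pos
  rw [← sq_eq_sq₀ (Real.cosh_pos _).le (by positivity), Real.cosh_sq', sinh_half_dist, div_pow,
    div_pow, mul_pow, Real.sq_sqrt (by positivity), eucl_dist_sq, mirror_dist_sq]
  field_simp
  ring

theorem dist_mirror_comm (p q : HypSpace) : dist p.toEucl q.mirror = dist q.toEucl p.mirror := by
  rw [← sq_eq_sq₀ dist_nonneg dist_nonneg, mirror_dist_sq, mirror_dist_sq, dist_comm p.z]
  ring

theorem dist_mirror_self (p : HypSpace) : dist p.toEucl p.mirror = 2 * p.t := by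
  have hp := p.t_pos
  rw [← sq_eq_sq₀ dist_nonneg (by positivity), mirror_dist_sq, dist_self]
  ring

protected theorem dist_triangle (a b c : HypSpace) : dist a c ≤ dist a b + dist b c := by
  have ha := a.t_pos
  have hb := b.t_pos
  have hc := c.t_pos
  have hpt := EuclideanGeometry.mul_dist_le_mul_dist_add_mul_dist
    a.toEucl b.toEucl c.toEucl b.mirror
  rw [dist_mirror_self] at hpt
  have key : Real.sinh (dist a c / 2) ≤ Real.sinh (dist a b / 2 + dist b c / 2) := by
    rw [Real.sinh_add, sinh_half_dist, sinh_half_dist, sinh_half_dist, cosh_half_dist,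
      cosh_half_dist, dist_mirror_comm b c, Real.sqrt_mul ha.le, Real.sqrt_mul ha.le,
      Real.sqrt_mul hb.le]
    have h1 : dist a.toEucl b.toEucl / (2 * (√a.t * √b.t)) *
          (dist c.toEucl b.mirror / (2 * (√b.t * √c.t))) +
        dist a.toEucl b.mirror / (2 * (√a.t * √b.t)) *
          (dist b.toEucl c.toEucl / (2 * (√b.t * √c.t))) =
        (dist a.toEucl b.toEucl * dist c.toEucl b.mirror +
          dist b.toEucl c.toEucl * dist a.toEucl b.mirror) /
          (2 * b.t * (2 * (√a.t * √c.t))) := by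
      rw [div_mul_div_comm, div_mul_div_comm, ← add_div]
      have : 2 * (√a.t * √b.t) * (2 * (√b.t * √c.t)) = 2 * b.t * (2 * (√a.t * √c.t)) := by
        linear_combination 4 * √a.t * √c.t * Real.mul_self_sqrt hb.le
      rw [this]
      ring
    rw [h1, le_div_iff₀ (by positivity)]
    have h2 : dist a.toEucl c.toEucl / (2 * (√a.t * √c.t)) * (2 * b.t * (2 * (√a.t * √c.t))) =
        dist a.toEucl c.toEucl * (2 * b.t) := by
      field_simp
    rw [h2]
    exact hpt
  have := Real.sinh_le_sinh.1 key
  linarith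

/-- Hyperbolic 3-space as a metric space. -/
instance : MetricSpace HypSpace where
  dist_self p := by simp [dist_def]
  dist_comm p q := by rw [dist_def, dist_def, dist_comm p.toEucl, mul_comm p.t]
  dist_triangle := HypSpace.dist_triangle
  eq_of_dist_eq_zero {p q} h := by
    have hp := p.t_pos
    have hq := q.t_pos
    have h0 : dist p.toEucl q.toEucl ^ 2 = 0 := by
      have h1 := sinh_half_dist p q
      rw [h, zero_div, Real.sinh_zero, eq_comm, div_eq_zero_iff] at h1
      rcases h1 with h1 | h1
      · rw [h1]; norm_num
      · exact absurd h1 (by positivity)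
    rw [eucl_dist_sq] at h0
    have hz : dist p.z q.z = 0 := by nlinarith [sq_nonneg (dist p.z q.z), sq_nonneg (p.t - q.t)]
    have ht : p.t - q.t = 0 := by nlinarith [sq_nonneg (dist p.z q.z), sq_nonneg (p.t - q.t)]
    exact HypSpace.ext (dist_eq_zero.1 hz) (sub_eq_zero.1 ht)

end HypSpace

/-- The group of isometries of hyperbolic 3-space. -/
abbrev HypIsom := HypSpace ≃ᵢ HypSpace

/-- The tautological action of the isometry group. -/
instance : MulAction HypIsom HypSpace where
  smul g p := g p
  one_smul _ := rfl
  mul_smul _ _ _ := rfl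

/-- The Riemann sphere `ℂ ∪ {∞}`, the ideal boundary of hyperbolic 3-space. -/
abbrev Sphere := OnePoint ℂ

/-- The orbit space `H³ / Γ`, with the quotient topology. -/
abbrev HypQuotient (Γ : Subgroup HypIsom) := MulAction.orbitRel.Quotient Γ HypSpace

/-- A nice lattice (co-compact torsion-free lattice): the quotient `H³ / Γ` is a compact Hausdorff
space and the projection `H³ → H³ / Γ` is a covering map; so `H³ / Γ` is a compact
hyperbolic manifold, with universal covering `H³` and deck group `Γ`. -/
structure IsNiceLattice (Γ : Subgroup HypIsom) : Prop where
  covering : IsCoveringMap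
    (Quotient.mk (MulAction.orbitRel Γ HypSpace) : HypSpace → HypQuotient Γ)
  hausdorff : T2Space (HypQuotient Γ)
  compact : CompactSpace (HypQuotient Γ)

/-- `H³` inside the one-point compactification of `ℂ × ℝ`. -/
def interiorPt (p : HypSpace) : OnePoint (ℂ × ℝ) := ((p.z, p.t) : ℂ × ℝ)

/-- The ideal boundary inside the one-point compactification of `ℂ × ℝ`: `z ↦ (z, 0)`,
`∞ ↦ ∞`. Together with `H³` it forms the closed ball `H³ ∪ S`. -/
def idealPt (ξ : Sphere) : OnePoint (ℂ × ℝ) := OnePoint.map (fun z : ℂ => (z, (0 : ℝ))) ξ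

/-- The homeomorphism `σ` of the sphere extends the isometry `g` of `H³` continuously:
`g p → σ ξ` whenever `p ∈ H³` tends to the ideal point `ξ`. -/
def ExtendsToSphere (g : HypIsom) (σ : Sphere ≃ₜ Sphere) : Prop :=
  ∀ ξ : Sphere, Tendsto (fun p : HypSpace => interiorPt (g p))
    (comap interiorPt (𝓝 (idealPt ξ))) (𝓝 (idealPt (σ ξ)))

/-- The homeomorphisms by which the elements of `Γ` act on the sphere. -/
def sphereAction (Γ : Subgroup HypIsom) : Set (Sphere ≃ₜ Sphere) :=
  {σ | ∃ g ∈ Γ, ExtendsToSphere g σ}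

/-- `h` is equivariant: `h Γ₁ h⁻¹ = Γ₂`, as groups acting on the sphere, for some pair of
nice lattices `Γ₁`, `Γ₂`. -/
def IsEquivariantHomeo (h : Sphere ≃ₜ Sphere) : Prop :=
  ∃ Γ₁ Γ₂ : Subgroup HypIsom, IsNiceLattice Γ₁ ∧ IsNiceLattice Γ₂ ∧
    (fun σ : Sphere ≃ₜ Sphere => h * σ * h⁻¹) '' sphereAction Γ₁ = sphereAction Γ₂

/-- A round disk in the plane, open or closed, of positive radius. -/
def IsDisk (D : Set ℂ) : Prop :=
  ∃ (c : ℂ) (r : ℝ), 0 < r ∧ (D = Metric.ball c r ∨ D = Metric.closedBall c r)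

/-- A subset of the plane seen in the sphere. -/
def inSphere (A : Set ℂ) : Set Sphere := (fun z : ℂ => (z : Sphere)) '' A

end

noncomputable section

namespace HypSpace

/-! Each point `p` of hyperbolic space sees the ideal sphere as round, with squared half-chordal
distance `p.idealChord`. Isometries transport these functions (`ExtendsToSphere.idealChord_eq`), and
moving `p` by `d` changes them by a factor at most `exp (2 * d)` (`idealChord_le`). Let `‖x - c‖ ≤
‖y - c‖`. From the point `p` at height `‖y - c‖` above `c`, the pairs `y, c` and `x, ∞` look far
apart. Cocompactness of `Γ₁` brings `p` within a fixed distance of `base`, where compactness of the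
sphere keeps the `h`-images of these pairs apart. Equivariance turns this into a statement about the
original images, seen from some other point. The ratio of `‖x - c‖` to `‖y - c‖` is a cross ratio
with `∞`, computable from any viewpoint, so it is bounded for the images. Hence `h` is weakly
quasisymmetric, which is the disk property. -/

theorem tendsto_apply₂ {α Y Z : Type*} [TopologicalSpace Y] [TopologicalSpace Z] {c : Y → Y → Z}
    (hc : Continuous fun x : Y × Y => c x.1 x.2) {F : Filter α} {f f' : α → Y} {a b : Y}
    (hf : Tendsto f F (𝓝 a)) (hf' : Tendsto f' F (𝓝 b)) :
    Tendsto (fun x => c (f x) (f' x)) F (𝓝 (c a b)) :=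
  (hc.tendsto (a, b)).comp (hf.prodMk_nhds hf')

/-- The base point `(0, 1)`. -/
def base : HypSpace := ⟨0, 1, one_pos⟩

/-! ### The chordal function of the closed ball seen from a point -/

/-- The numerator of `cosh (dist p (z, t))`, as a function of `(z, t)`. -/
def coshNum (p : HypSpace) (a : ℂ × ℝ) : ℝ := ‖a.1 - p.z‖ ^ 2 + a.2 ^ 2 + p.t ^ 2

theorem coshNum_pos (p : HypSpace) (a : ℂ × ℝ) : 0 < p.coshNum a := by
  have := p.t_pos
  unfold coshNum
  positivity

theorem continuous_coshNum (p : HypSpace) : Continuous p.coshNum := by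
  unfold coshNum
  fun_prop

theorem cosh_dist_eq (p q : HypSpace) :
    Real.cosh (dist q p) = p.coshNum (q.z, q.t) / (2 * q.t * p.t) := by
  have hp := p.t_pos
  have hq := q.t_pos
  rw [cosh_dist, coshNum, dist_eq_norm]
  field_simp
  ring

theorem tendsto_coshNum (p : HypSpace) : Tendsto p.coshNum (cocompact (ℂ × ℝ)) atTop := by
  have h := tendsto_dist_right_cocompact_atTop ((p.z, 0) : ℂ × ℝ)
  refine tendsto_atTop_mono (fun a => ?_) ((tendsto_pow_atTop two_ne_zero).comp h)
  simp only [Function.comp, coshNum, Prod.dist_eq, Real.dist_eq, dist_eq_norm a.1, sub_zero]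
  rcases max_cases ‖a.1 - p.z‖ |a.2| with ⟨e, -⟩ | ⟨e, -⟩ <;> rw [e]
  · nlinarith [sq_nonneg a.2, sq_nonneg p.t]
  · rw [sq_abs]
    nlinarith [sq_nonneg ‖a.1 - p.z‖, sq_nonneg p.t]

/-- Extension by zero of a function to the one-point compactification. -/
def extendZero {Y E : Type*} [Zero E] (f : Y → E) (a : OnePoint Y) : E := a.elim 0 f

@[simp] theorem extendZero_coe {Y E : Type*} [Zero E] (f : Y → E) (a : Y) :
    extendZero f (a : OnePoint Y) = f a := rfl

@[simp] theorem extendZero_infty {Y E : Type*} [Zero E] (f : Y → E) :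
    extendZero f OnePoint.infty = 0 := rfl

theorem continuous_extendZero {Y E : Type*} [TopologicalSpace Y] [T2Space Y] [TopologicalSpace E]
    [Zero E] {f : Y → E} (hf : Continuous f) (h0 : Tendsto f (cocompact Y) (𝓝 0)) :
    Continuous (extendZero f) := by
  rw [OnePoint.continuous_iff, coclosedCompact_eq_cocompact]
  exact ⟨h0, hf⟩

/-- The scaling coordinate of the inverse stereographic projection based at `p`. -/
def scaleCoord (p : HypSpace) : OnePoint (ℂ × ℝ) → ℝ :=
  extendZero fun a => p.t ^ 2 / p.coshNum a

/-- The horizontal coordinate of the inverse stereographic projection based at `p`. -/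
def horizCoord (p : HypSpace) : OnePoint (ℂ × ℝ) → ℂ :=
  extendZero fun a => ((p.t / p.coshNum a : ℝ) : ℂ) * (a.1 - p.z)

/-- The vertical coordinate of the inverse stereographic projection based at `p`. -/
def vertCoord (p : HypSpace) : OnePoint (ℂ × ℝ) → ℝ :=
  extendZero fun a => p.t * a.2 / p.coshNum a

theorem tendsto_scale (p : HypSpace) :
    Tendsto (fun a => p.t ^ 2 / p.coshNum a) (cocompact (ℂ × ℝ)) (𝓝 0) :=
  tendsto_const_nhds.div_atTop p.tendsto_coshNum

/-- The squared norm of the full coordinate vector equals `scaleCoord`, so `scaleCoord` controls the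
other two coordinates near infinity. -/
theorem tendsto_zero_of_sq_le_scale {E : Type*} [NormedAddCommGroup E] (p : HypSpace)
    {f : ℂ × ℝ → E} (hf : ∀ a, ‖f a‖ ^ 2 ≤ p.t ^ 2 / p.coshNum a) :
    Tendsto f (cocompact (ℂ × ℝ)) (𝓝 0) := by
  have h := (Real.continuous_sqrt.tendsto 0).comp p.tendsto_scale
  rw [Real.sqrt_zero] at h
  exact squeeze_zero_norm (fun a => Real.le_sqrt_of_sq_le (hf a)) h

theorem continuous_scaleCoord (p : HypSpace) : Continuous p.scaleCoord :=
  continuous_extendZero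
    (continuous_const.div p.continuous_coshNum fun a => (p.coshNum_pos a).ne') p.tendsto_scale

theorem continuous_horizCoord (p : HypSpace) : Continuous p.horizCoord := by
  refine continuous_extendZero ?_ (p.tendsto_zero_of_sq_le_scale fun a => ?_)
  · have := continuous_const.div p.continuous_coshNum (fun a => (p.coshNum_pos a).ne')
      (f := fun _ => p.t)
    exact (Complex.continuous_ofReal.comp this).mul (by fun_prop)
  · have hA := p.coshNum_pos a
    rw [norm_mul, Complex.norm_real, Real.norm_eq_abs, mul_pow, sq_abs, div_pow, div_mul_eq_mul_div,
      div_le_div_iff₀ (by positivity) hA]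
    have : ‖a.1 - p.z‖ ^ 2 ≤ p.coshNum a := by
      unfold coshNum; nlinarith [sq_nonneg a.2, sq_nonneg p.t]
    calc p.t ^ 2 * ‖a.1 - p.z‖ ^ 2 * p.coshNum a ≤ p.t ^ 2 * p.coshNum a * p.coshNum a := by gcongr
      _ = _ := by ring

theorem continuous_vertCoord (p : HypSpace) : Continuous p.vertCoord := by
  refine continuous_extendZero ?_ (p.tendsto_zero_of_sq_le_scale fun a => ?_)
  · exact (by fun_prop : Continuous fun a : ℂ × ℝ => p.t * a.2).div p.continuous_coshNum
      fun a => (p.coshNum_pos a).ne'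
  · have hA := p.coshNum_pos a
    rw [Real.norm_eq_abs, sq_abs, div_pow, mul_pow, div_le_div_iff₀ (by positivity) hA]
    have : a.2 ^ 2 ≤ p.coshNum a := by
      unfold coshNum; nlinarith [sq_nonneg ‖a.1 - p.z‖, sq_nonneg p.t]
    calc p.t ^ 2 * a.2 ^ 2 * p.coshNum a ≤ p.t ^ 2 * p.coshNum a * p.coshNum a := by gcongr
      _ = _ := by ring

/-- The square of half the chordal distance on `(ℂ × ℝ) ∪ {∞}`, normalized to be round as seen
from the point `p`. -/
def chord (p : HypSpace) (a b : OnePoint (ℂ × ℝ)) : ℝ :=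
  p.scaleCoord a + p.scaleCoord b - 2 * (p.scaleCoord a * p.scaleCoord b) -
    2 * (p.horizCoord a * (starRingEnd ℂ) (p.horizCoord b)).re -
    2 * (p.vertCoord a * p.vertCoord b)

theorem continuous_chord (p : HypSpace) :
    Continuous fun x : OnePoint (ℂ × ℝ) × OnePoint (ℂ × ℝ) => p.chord x.1 x.2 := by
  have h1 := p.continuous_scaleCoord
  have h2 := p.continuous_horizCoord
  have h3 := p.continuous_vertCoord
  have h4 := Complex.continuous_conj
  have h5 := Complex.continuous_re
  unfold chord
  fun_prop

/-- The vector `v` of the three coordinates satisfies `|v|² = scaleCoord`: it lies on a sphere of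
radius 1/2 through the origin, the image of infinity. Thus `chord` is `|v a - v b|²` expanded. -/
theorem chord_coe_coe (p : HypSpace) (a b : ℂ × ℝ) :
    p.chord a b =
      p.t ^ 2 * (‖a.1 - b.1‖ ^ 2 + (a.2 - b.2) ^ 2) / (p.coshNum a * p.coshNum b) := by
  have hA := p.coshNum_pos a
  have hB := p.coshNum_pos b
  simp only [chord, scaleCoord, horizCoord, vertCoord, extendZero_coe]
  have e : ((((p.t / p.coshNum a : ℝ) : ℂ) * (a.1 - p.z)) *
      (starRingEnd ℂ) (((p.t / p.coshNum b : ℝ) : ℂ) * (b.1 - p.z))).re =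
      p.t / p.coshNum a * (p.t / p.coshNum b) *
        ((a.1.re - p.z.re) * (b.1.re - p.z.re) + (a.1.im - p.z.im) * (b.1.im - p.z.im)) := by
    simp only [map_mul, Complex.conj_ofReal, Complex.mul_re, Complex.mul_im, Complex.ofReal_re,
      Complex.ofReal_im, Complex.conj_re, Complex.conj_im, Complex.sub_re, Complex.sub_im, map_sub]
    ring
  rw [e]
  field_simp
  simp only [coshNum, ← Complex.normSq_eq_norm_sq, Complex.normSq_apply, Complex.sub_re,
    Complex.sub_im]
  ring

theorem chord_comm (p : HypSpace) (a b : OnePoint (ℂ × ℝ)) : p.chord a b = p.chord b a := by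
  simp only [chord, Complex.mul_re, Complex.conj_re, Complex.conj_im]
  ring

@[simp] theorem chord_coe_infty (p : HypSpace) (a : ℂ × ℝ) :
    p.chord a OnePoint.infty = p.t ^ 2 / p.coshNum a := by
  simp [chord, scaleCoord, horizCoord, vertCoord]

theorem chord_self (p : HypSpace) (a : OnePoint (ℂ × ℝ)) : p.chord a a = 0 := by
  induction a using OnePoint.rec with
  | infty => simp [chord, scaleCoord, horizCoord, vertCoord]
  | coe a => simp [chord_coe_coe]

theorem chord_pos (p : HypSpace) {a b : OnePoint (ℂ × ℝ)} (hab : a ≠ b) : 0 < p.chord a b := by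
  have hp := p.t_pos
  have key (a : ℂ × ℝ) : 0 < p.chord a OnePoint.infty := by
    have := p.coshNum_pos a
    rw [chord_coe_infty]
    positivity
  induction a using OnePoint.rec with
  | infty =>
    induction b using OnePoint.rec with
    | infty => exact absurd rfl hab
    | coe b => rw [chord_comm]; exact key b
  | coe a =>
    induction b using OnePoint.rec with
    | infty => exact key a
    | coe b =>
      have hA := p.coshNum_pos a
      have hB := p.coshNum_pos b
      have hne : a ≠ b := fun h => hab (congrArg _ h)
      have : 0 < ‖a.1 - b.1‖ ^ 2 + (a.2 - b.2) ^ 2 := by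
        by_cases h1 : a.1 = b.1
        · have h2 : a.2 - b.2 ≠ 0 := fun h => hne (Prod.ext h1 (sub_eq_zero.1 h))
          positivity
        · have := norm_pos_iff.2 (sub_ne_zero.2 h1)
          positivity
      rw [chord_coe_coe]
      positivity

theorem eq_of_chord_eq_zero (p : HypSpace) {a b : OnePoint (ℂ × ℝ)} (h : p.chord a b = 0) :
    a = b := by
  by_contra hab
  exact (p.chord_pos hab).ne' h

/-- Only hyperbolic distances occur on the right, so invariance under isometries needs no
description of isometries as Möbius maps. -/
theorem chord_interiorPt (p q q' : HypSpace) :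
    p.chord (interiorPt q) (interiorPt q') =
      (Real.cosh (dist q q') - 1) / (2 * (Real.cosh (dist q p) * Real.cosh (dist q' p))) := by
  have hp := p.t_pos
  have hq := q.t_pos
  have hq' := q'.t_pos
  have hA := p.coshNum_pos (q.z, q.t)
  have hB := p.coshNum_pos (q'.z, q'.t)
  rw [interiorPt, interiorPt, chord_coe_coe, cosh_dist_eq p q, cosh_dist_eq p q', cosh_dist,
    dist_eq_norm]
  field_simp
  ring

theorem chord_isometry (g : HypIsom) (p q q' : HypSpace) :
    (g p).chord (interiorPt (g q)) (interiorPt (g q')) =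
      p.chord (interiorPt q) (interiorPt q') := by
  simp only [chord_interiorPt, g.dist_eq]

theorem vertCoord_interiorPt (p q : HypSpace) :
    p.vertCoord (interiorPt q) = 1 / (2 * Real.cosh (dist q p)) := by
  have hp := p.t_pos
  have hq := q.t_pos
  have hA := p.coshNum_pos (q.z, q.t)
  rw [cosh_dist_eq, vertCoord, interiorPt, extendZero_coe]
  field_simp

theorem vertCoord_isometry (g : HypIsom) (p q : HypSpace) :
    (g p).vertCoord (interiorPt (g q)) = p.vertCoord (interiorPt q) := by
  simp only [vertCoord_interiorPt, g.dist_eq]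

/-! ### The ideal boundary and its chordal functions -/

@[simp] theorem idealPt_infty : idealPt OnePoint.infty = OnePoint.infty := rfl

@[simp] theorem idealPt_coe (z : ℂ) : idealPt (z : Sphere) = ((z, (0 : ℝ)) : ℂ × ℝ) := rfl

theorem vertCoord_idealPt (p : HypSpace) (ξ : Sphere) : p.vertCoord (idealPt ξ) = 0 := by
  induction ξ using OnePoint.rec with
  | infty => simp [vertCoord]
  | coe z => simp [vertCoord]

theorem exists_idealPt_of_vertCoord_eq_zero (p : HypSpace) {e : OnePoint (ℂ × ℝ)}
    (h : p.vertCoord e = 0) : ∃ ξ, idealPt ξ = e := by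
  induction e using OnePoint.rec with
  | infty => exact ⟨OnePoint.infty, rfl⟩
  | coe a =>
    have hA := p.coshNum_pos a
    have hp := p.t_pos
    have h2 : a.2 = 0 := by
      simpa [vertCoord, hA.ne', hp.ne'] using h
    exact ⟨(a.1 : Sphere), by rw [idealPt_coe, ← h2]⟩

theorem idealPt_injective : Function.Injective idealPt := by
  intro ξ η h
  induction ξ using OnePoint.rec with
  | infty =>
    induction η using OnePoint.rec with
    | infty => rfl
    | coe w => exact absurd h.symm (OnePoint.coe_ne_infty _)
  | coe z =>
    induction η using OnePoint.rec with
    | infty => exact absurd h (OnePoint.coe_ne_infty _)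
    | coe w =>
      rw [idealPt_coe, idealPt_coe, OnePoint.coe_eq_coe, Prod.mk.injEq] at h
      rw [h.1]

theorem continuous_idealPt : Continuous idealPt := by
  refine OnePoint.continuous_map (by fun_prop) ?_
  rw [coclosedCompact_eq_cocompact, coclosedCompact_eq_cocompact]
  exact (Topology.IsClosedEmbedding.tendsto_cocompact
    (f := fun z : ℂ => (z, (0 : ℝ))) ⟨isEmbedding_prodMkLeft 0, by
      have : Set.range (fun z : ℂ => (z, (0 : ℝ))) = Prod.snd ⁻¹' {0} := by
        ext ⟨z, t⟩
        simp [eq_comm]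
      rw [this]
      exact isClosed_singleton.preimage continuous_snd⟩)

/-- The filter of points of hyperbolic space tending to an ideal point. -/
def toIdeal (ξ : Sphere) : Filter HypSpace := comap interiorPt (𝓝 (idealPt ξ))

theorem tendsto_toIdeal (ξ : Sphere) : Tendsto interiorPt (toIdeal ξ) (𝓝 (idealPt ξ)) :=
  tendsto_comap

/-- A vertical geodesic converges to the ideal point. Nontriviality of the filter makes limits at
the boundary unique. -/
instance toIdeal_neBot (ξ : Sphere) : (toIdeal ξ).NeBot := by
  induction ξ using OnePoint.rec with
  | infty =>
    have h : Tendsto (fun s : ℝ => interiorPt ⟨0, Real.exp s, Real.exp_pos s⟩) atTop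
        (𝓝 (idealPt OnePoint.infty)) := by
      have h1 : Tendsto (fun s : ℝ => ((0, Real.exp s) : ℂ × ℝ)) atTop (cocompact (ℂ × ℝ)) := by
        rw [← Metric.cobounded_eq_cocompact, ← tendsto_norm_atTop_iff_cobounded]
        refine tendsto_atTop_mono (fun s => ?_) Real.tendsto_exp_atTop
        exact (le_abs_self _).trans (le_max_right _ _)
      rw [← coclosedCompact_eq_cocompact] at h1
      exact (OnePoint.tendsto_coe_infty).comp h1
    exact (tendsto_comap_iff.2 h : Tendsto (fun s : ℝ => (⟨0, Real.exp s, Real.exp_pos s⟩ :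
      HypSpace)) atTop (toIdeal OnePoint.infty)).neBot
  | coe z =>
    have h : Tendsto (fun s : ℝ => interiorPt ⟨z, Real.exp s, Real.exp_pos s⟩) atBot
        (𝓝 (idealPt z)) :=
      (OnePoint.continuous_coe.tendsto _).comp
        (tendsto_const_nhds.prodMk_nhds Real.tendsto_exp_atBot)
    exact (tendsto_comap_iff.2 h : Tendsto (fun s : ℝ => (⟨z, Real.exp s, Real.exp_pos s⟩ :
      HypSpace)) atBot (toIdeal z)).neBot

/-- The chordal function on the ideal boundary. -/
def idealChord (p : HypSpace) (ξ η : Sphere) : ℝ := p.chord (idealPt ξ) (idealPt η)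

theorem continuous_idealChord (p : HypSpace) :
    Continuous fun x : Sphere × Sphere => p.idealChord x.1 x.2 :=
  p.continuous_chord.comp (continuous_idealPt.prodMap continuous_idealPt)

theorem idealChord_pos (p : HypSpace) {ξ η : Sphere} (h : ξ ≠ η) : 0 < p.idealChord ξ η :=
  p.chord_pos (idealPt_injective.ne h)

theorem tendsto_chord (p : HypSpace) {α : Type*} {F : Filter α} {f f' : α → OnePoint (ℂ × ℝ)}
    {a b : OnePoint (ℂ × ℝ)} (hf : Tendsto f F (𝓝 a)) (hf' : Tendsto f' F (𝓝 b)) :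
    Tendsto (fun x => p.chord (f x) (f' x)) F (𝓝 (p.chord a b)) :=
  tendsto_apply₂ p.continuous_chord hf hf'

theorem tendsto_chord_toIdeal (p : HypSpace) (ξ η : Sphere) :
    Tendsto (fun x : HypSpace × HypSpace => p.chord (interiorPt x.1) (interiorPt x.2))
      (toIdeal ξ ×ˢ toIdeal η) (𝓝 (p.idealChord ξ η)) :=
  p.tendsto_chord ((tendsto_toIdeal ξ).comp tendsto_fst) ((tendsto_toIdeal η).comp tendsto_snd)

/-- The interior invariance passes to the limit. Any extension `σ` is allowed, since elements of
`sphereAction Γ₂` are known only through this property. -/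
theorem _root_.ExtendsToSphere.idealChord_eq {g : HypIsom} {σ : Sphere ≃ₜ Sphere}
    (hσ : ExtendsToSphere g σ) (p : HypSpace) (ξ η : Sphere) :
    (g p).idealChord (σ ξ) (σ η) = p.idealChord ξ η := by
  refine tendsto_nhds_unique ?_ (p.tendsto_chord_toIdeal ξ η)
  have h := (g p).tendsto_chord ((hσ ξ).comp (tendsto_fst (f := toIdeal ξ) (g := toIdeal η)))
    ((hσ η).comp (tendsto_snd (f := toIdeal ξ) (g := toIdeal η)))
  exact h.congr fun x => chord_isometry g p x.1 x.2

theorem cosh_le_exp_mul_cosh {x y D : ℝ} (hx : 0 ≤ x) (hy : 0 ≤ y) (hD : 0 ≤ D)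
    (h : x ≤ y + D) : Real.cosh x ≤ Real.exp D * Real.cosh y := by
  have h1 : Real.cosh x ≤ Real.cosh (y + D) := by
    rw [Real.cosh_le_cosh, abs_of_nonneg hx, abs_of_nonneg (by positivity)]
    exact h
  have h2 := Real.sinh_lt_cosh y
  have h3 := Real.sinh_nonneg_iff.2 hD
  rw [Real.cosh_add] at h1
  rw [← Real.cosh_add_sinh]
  nlinarith

/-- In `chord_interiorPt` only the two `cosh` factors of the denominator depend on `p`, and each
changes by at most `exp (dist p p')`. -/
theorem idealChord_le (p p' : HypSpace) (ξ η : Sphere) :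
    p.idealChord ξ η ≤ Real.exp (2 * dist p p') * p'.idealChord ξ η := by
  refine le_of_tendsto_of_tendsto' (p.tendsto_chord_toIdeal ξ η)
    ((p'.tendsto_chord_toIdeal ξ η).const_mul _) fun x => ?_
  have key (q : HypSpace) : Real.cosh (dist q p') ≤ Real.exp (dist p p') * Real.cosh (dist q p) :=
    cosh_le_exp_mul_cosh dist_nonneg dist_nonneg dist_nonneg (dist_triangle _ _ _)
  have h0 := Real.one_le_cosh (dist x.1 x.2)
  have c1 := Real.cosh_pos (dist x.1 p)
  have c2 := Real.cosh_pos (dist x.2 p)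
  have c3 := Real.cosh_pos (dist x.1 p')
  have c4 := Real.cosh_pos (dist x.2 p')
  rw [chord_interiorPt, chord_interiorPt, mul_div_assoc', div_le_div_iff₀ (by positivity)
    (by positivity)]
  have h1 := mul_le_mul (key x.1) (key x.2) c4.le (by positivity)
  have h2 : Real.exp (2 * dist p p') = Real.exp (dist p p') * Real.exp (dist p p') := by
    rw [← Real.exp_add, two_mul]
  rw [h2]
  nlinarith [mul_le_mul_of_nonneg_left h1 (sub_nonneg.2 h0)]

end HypSpace

/-! ### Extension of isometries to the sphere -/

theorem exists_tendsto_of_separating {α Z : Type*} [TopologicalSpace Z] [CompactSpace Z]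
    {c : Z → Z → ℝ} (hc : Continuous fun x : Z × Z => c x.1 x.2) (h0 : ∀ z z', c z z' = 0 → z = z')
    {F : Filter α} [F.NeBot] {f : α → Z}
    (hf : Tendsto (fun x : α × α => c (f x.1) (f x.2)) (F ×ˢ F) (𝓝 0)) :
    ∃ z, Tendsto f F (𝓝 z) := by
  have hf' : Tendsto (fun x : Z × Z => c x.1 x.2) (map f F ×ˢ map f F) (𝓝 0) := by
    rw [prod_map_map_eq]
    exact tendsto_map'_iff.2 hf
  obtain ⟨z, hz⟩ := exists_clusterPt_of_compactSpace (map f F)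
  -- By continuity `c` vanishes on any two cluster points, so they coincide.
  refine ⟨z, le_nhds_of_unique_clusterPt fun z' hz' => h0 _ _ ?_⟩
  have : (𝓝 z' ⊓ map f F).NeBot := hz'
  have : (𝓝 z ⊓ map f F).NeBot := hz
  refine tendsto_nhds_unique (f := fun x : Z × Z => c x.1 x.2)
    (l := (𝓝 z' ⊓ map f F) ×ˢ (𝓝 z ⊓ map f F)) ?_ ?_
  · refine (hc.tendsto (z', z)).mono_left ?_
    rw [nhds_prod_eq]
    exact prod_mono inf_le_left inf_le_left
  · exact hf'.mono_left (prod_mono inf_le_right inf_le_right)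

theorem tendsto_of_separating {α Z : Type*} [TopologicalSpace Z] [CompactSpace Z]
    {c : Z → Z → ℝ} (hc : Continuous fun x : Z × Z => c x.1 x.2) (h0 : ∀ z z', c z z' = 0 → z = z')
    {F : Filter α} {f : α → Z} {z : Z} (hf : Tendsto (fun x => c (f x) z) F (𝓝 0)) :
    Tendsto f F (𝓝 z) := by
  refine le_nhds_of_unique_clusterPt fun z' hz' => h0 _ _ ?_
  have : (𝓝 z' ⊓ map f F).NeBot := hz'
  refine tendsto_nhds_unique (f := fun x : Z => c x z) (l := 𝓝 z' ⊓ map f F) ?_ ?_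
  · exact ((hc.comp (Continuous.prodMk_left z)).tendsto z').mono_left inf_le_left
  · exact (tendsto_map'_iff.2 hf).mono_left inf_le_right

namespace HypSpace

/-- Invariance of `chord` makes the image of `toIdeal ξ` a Cauchy filter for the chordal distance.
The limit is ideal because `vertCoord` is also invariant and vanishes exactly on the boundary. -/
theorem exists_tendsto_idealPt (g : HypIsom) (ξ : Sphere) :
    ∃ η : Sphere, Tendsto (fun q => interiorPt (g q)) (toIdeal ξ) (𝓝 (idealPt η)) := by
  set p := g.symm base with hp
  have hgp : g p = base := g.apply_symm_apply base
  obtain ⟨e, he⟩ := exists_tendsto_of_separating base.continuous_chord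
    (fun _ _ => base.eq_of_chord_eq_zero) (F := toIdeal ξ) (f := fun q => interiorPt (g q)) (by
      have h := p.tendsto_chord_toIdeal ξ ξ
      rw [idealChord, chord_self] at h
      refine h.congr fun x => ?_
      rw [← hgp, chord_isometry])
  have hv : base.vertCoord e = 0 := by
    refine tendsto_nhds_unique ((base.continuous_vertCoord.tendsto e).comp he) ?_
    have h := (p.continuous_vertCoord.tendsto (idealPt ξ)).comp (tendsto_toIdeal ξ)
    rw [vertCoord_idealPt] at h
    refine h.congr fun q => ?_
    simp only [Function.comp]
    rw [← hgp, vertCoord_isometry]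
  obtain ⟨η, rfl⟩ := exists_idealPt_of_vertCoord_eq_zero _ hv
  exact ⟨η, he⟩

/-- The boundary map of an isometry. -/
def boundaryMap (g : HypIsom) (ξ : Sphere) : Sphere := (exists_tendsto_idealPt g ξ).choose

theorem tendsto_boundaryMap (g : HypIsom) (ξ : Sphere) :
    Tendsto (fun q => interiorPt (g q)) (toIdeal ξ) (𝓝 (idealPt (boundaryMap g ξ))) :=
  (exists_tendsto_idealPt g ξ).choose_spec

theorem tendsto_toIdeal_boundaryMap (g : HypIsom) (ξ : Sphere) :
    Tendsto g (toIdeal ξ) (toIdeal (boundaryMap g ξ)) :=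
  tendsto_comap_iff.2 (tendsto_boundaryMap g ξ)

theorem boundaryMap_symm_apply (g : HypIsom) (ξ : Sphere) :
    boundaryMap g.symm (boundaryMap g ξ) = ξ := by
  refine idealPt_injective (tendsto_nhds_unique
    ((tendsto_boundaryMap g.symm _).comp (tendsto_toIdeal_boundaryMap g ξ)) ?_)
  refine (tendsto_toIdeal ξ).congr fun q => ?_
  simp

theorem idealChord_boundaryMap (g : HypIsom) (p : HypSpace) (ξ η : Sphere) :
    (g p).idealChord (boundaryMap g ξ) (boundaryMap g η) = p.idealChord ξ η := by
  refine tendsto_nhds_unique ?_ (p.tendsto_chord_toIdeal ξ η)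
  exact ((g p).tendsto_chord_toIdeal _ _).comp
    ((tendsto_toIdeal_boundaryMap g ξ).prodMap (tendsto_toIdeal_boundaryMap g η)) |>.congr
    fun x => chord_isometry g p x.1 x.2

theorem continuous_boundaryMap (g : HypIsom) : Continuous (boundaryMap g) := by
  refine continuous_iff_continuousAt.2 fun ξ => tendsto_of_separating
    (g base).continuous_idealChord
    (fun _ _ h => idealPt_injective ((g base).eq_of_chord_eq_zero h)) ?_
  simp only [idealChord_boundaryMap]
  have h := (base.continuous_idealChord.comp (Continuous.prodMk_left ξ)).tendsto ξ
  simpa only [Function.comp_def, idealChord, chord_self] using h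

theorem exists_extendsToSphere (g : HypIsom) : ∃ σ, ExtendsToSphere g σ :=
  ⟨{ toFun := boundaryMap g
     invFun := boundaryMap g.symm
     left_inv := boundaryMap_symm_apply g
     right_inv := boundaryMap_symm_apply g.symm
     continuous_toFun := continuous_boundaryMap g
     continuous_invFun := continuous_boundaryMap g.symm }, tendsto_boundaryMap g⟩

/-! ### Cocompactness and the cross ratio -/

theorem exists_dist_le_of_compact (Γ : Subgroup HypIsom) [CompactSpace (HypQuotient Γ)]
    (o : HypSpace) : ∃ R : ℝ, ∀ p : HypSpace, ∃ g ∈ Γ, dist (g p) o ≤ R := by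
  have : ContinuousConstSMul Γ HypSpace := ⟨fun g => g.1.continuous⟩
  -- The images of the balls about `o` form an increasing open cover of the compact quotient, so one
  -- ball meets every orbit.
  have hopen : IsOpenMap (Quotient.mk (MulAction.orbitRel Γ HypSpace)) :=
    isOpenMap_quotient_mk'_mul
  obtain ⟨n, hn⟩ := (isCompact_univ (X := HypQuotient Γ)).elim_directed_cover
    (fun n : ℕ => Quotient.mk (MulAction.orbitRel Γ HypSpace) '' Metric.ball o n)
    (fun n => hopen _ Metric.isOpen_ball) (fun x _ => by
      obtain ⟨p, rfl⟩ := Quotient.exists_rep x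
      obtain ⟨n, hn⟩ := exists_nat_gt (dist p o)
      exact Set.mem_iUnion.2 ⟨n, p, hn, rfl⟩)
    (Monotone.directed_le fun m n hmn =>
      Set.image_mono (Metric.ball_subset_ball (Nat.cast_le.2 hmn)))
  refine ⟨n, fun p => ?_⟩
  obtain ⟨q, hq, hqp⟩ := hn (Set.mem_univ (Quotient.mk (MulAction.orbitRel Γ HypSpace) p))
  obtain ⟨g, hg⟩ := MulAction.orbitRel_apply.1 (Quotient.exact hqp)
  refine ⟨g.1, g.2, ?_⟩
  have hg' : g.1 p = q := hg
  rw [hg']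
  exact (Metric.mem_ball.1 hq).le

theorem idealChord_coe_coe (p : HypSpace) (z w : ℂ) :
    p.idealChord z w =
      p.t ^ 2 * ‖z - w‖ ^ 2 / ((‖z - p.z‖ ^ 2 + p.t ^ 2) * (‖w - p.z‖ ^ 2 + p.t ^ 2)) := by
  simp [idealChord, chord_coe_coe, coshNum]

theorem idealChord_coe_infty (p : HypSpace) (z : ℂ) :
    p.idealChord z OnePoint.infty = p.t ^ 2 / (‖z - p.z‖ ^ 2 + p.t ^ 2) := by
  simp [idealChord, coshNum]

/-- The cross ratio with one point at infinity, in terms of any chordal function. -/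
theorem norm_sq_mul_idealChord (p : HypSpace) (x y c : ℂ) :
    ‖x - c‖ ^ 2 * (p.idealChord y c * p.idealChord x OnePoint.infty) =
      ‖y - c‖ ^ 2 * (p.idealChord x c * p.idealChord y OnePoint.infty) := by
  simp only [idealChord_coe_coe, idealChord_coe_infty]
  have hp := p.t_pos
  field_simp

end HypSpace

/-! ### Quasisymmetry of equivariant homeomorphisms -/

open HypSpace

/-- The pairs at chordal value at least `ε` form a compact set off the diagonal, and `h` is
injective. -/
theorem exists_pos_le_idealChord_image (h : Sphere ≃ₜ Sphere) (p : HypSpace) {ε : ℝ}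
    (hε : 0 < ε) :
    ∃ δ > 0, ∀ ξ η, ε ≤ p.idealChord ξ η → δ ≤ p.idealChord (h ξ) (h η) := by
  have hK : IsCompact {x : Sphere × Sphere | ε ≤ p.idealChord x.1 x.2} :=
    (isClosed_le continuous_const p.continuous_idealChord).isCompact
  have hcont : Continuous fun x : Sphere × Sphere => p.idealChord (h x.1) (h x.2) :=
    p.continuous_idealChord.comp (h.continuous.prodMap h.continuous)
  rcases Set.eq_empty_or_nonempty {x : Sphere × Sphere | ε ≤ p.idealChord x.1 x.2} with he | hne
  · exact ⟨1, one_pos, fun ξ η hx => absurd hx (Set.eq_empty_iff_forall_notMem.1 he (ξ, η))⟩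
  · obtain ⟨x, hx, hmin⟩ := hK.exists_isMinOn hne hcont.continuousOn
    refine ⟨_, p.idealChord_pos (h.injective.ne (a₁ := x.1) (a₂ := x.2) fun e => ?_),
      fun ξ η hξ => hmin (show (ξ, η) ∈ _ from hξ)⟩
    have hx' : ε ≤ p.idealChord x.1 x.2 := hx
    rw [e, idealChord, chord_self] at hx'
    linarith

/-- An equivariant homeomorphism fixing infinity is weakly quasisymmetric on the plane. -/
theorem IsEquivariantHomeo.exists_quasisymmetric {h : Sphere ≃ₜ Sphere}
    (hequiv : IsEquivariantHomeo h) (hinf : h OnePoint.infty = OnePoint.infty) :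
    ∃ K : ℝ, 0 < K ∧ ∀ x y c x' y' c' : ℂ, h x = x' → h y = y' → h c = c' → y ≠ c →
      ‖x - c‖ ≤ ‖y - c‖ → ‖x' - c'‖ ≤ K * ‖y' - c'‖ := by
  obtain ⟨Γ₁, Γ₂, h₁, -, hΓ⟩ := hequiv
  have := h₁.compact
  obtain ⟨R, hR⟩ := exists_dist_le_of_compact Γ₁ base
  -- A chordal value 1/2 seen from `p` loses at most `exp (2 * R)` when the viewpoint moves from `g
  -- p` to `base`.
  obtain ⟨δ, hδ, hδ'⟩ := exists_pos_le_idealChord_image h base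
    (ε := Real.exp (-(2 * R)) / 2) (by positivity)
  obtain ⟨M, hM⟩ := (isCompact_univ (X := Sphere × Sphere)).exists_bound_of_continuousOn
    base.continuous_idealChord.continuousOn
  have hM' (ξ η : Sphere) : |base.idealChord ξ η| ≤ M := hM (ξ, η) (Set.mem_univ _)
  have hM0 : 0 < M :=
    (base.idealChord_pos (OnePoint.coe_ne_infty (0 : ℂ))).trans_le ((le_abs_self _).trans (hM' _ _))
  refine ⟨M / δ, by positivity, fun x y c x' y' c' hx hy hc hyc hle => ?_⟩
  have hr : 0 < ‖y - c‖ := norm_pos_iff.2 (sub_ne_zero.2 hyc)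
  -- From here `y, c` have chordal value exactly 1/2, and `x, ∞` at least 1/2.
  let p : HypSpace := ⟨c, ‖y - c‖, hr⟩
  obtain ⟨g, hg, hgR⟩ := hR p
  obtain ⟨σ, hσ⟩ := exists_extendsToSphere g
  have hmem : h * σ * h⁻¹ ∈ sphereAction Γ₂ := hΓ ▸ ⟨σ, ⟨g, hg, hσ⟩, rfl⟩
  obtain ⟨g', -, hσ'⟩ := hmem
  have hconj (ξ : Sphere) : (h * σ * h⁻¹) (h ξ) = h (σ ξ) :=
    congrArg (fun η => h (σ η)) (h.symm_apply_apply ξ)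
  -- The values at `base` after `σ` and `h` are those of the original image points seen from
  -- `g'.symm base`.
  have hback (ξ η : Sphere) : (g'.symm base).idealChord (h ξ) (h η) =
      base.idealChord (h (σ ξ)) (h (σ η)) := by
    rw [← hσ'.idealChord_eq, hconj, hconj, g'.apply_symm_apply]
  have hspread (ξ η : Sphere) (hs : 1 / 2 ≤ p.idealChord ξ η) :
      δ ≤ base.idealChord (h (σ ξ)) (h (σ η)) := by
    refine hδ' _ _ ?_
    have h1 := (g p).idealChord_le base (σ ξ) (σ η)
    rw [hσ.idealChord_eq] at h1
    have h0 : 0 < base.idealChord (σ ξ) (σ η) := by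
      by_contra hneg
      have := mul_nonpos_of_nonneg_of_nonpos (Real.exp_pos (2 * dist (g p) base)).le
        (not_lt.1 hneg)
      linarith
    have h2 : Real.exp (2 * dist (g p) base) ≤ Real.exp (2 * R) := by
      rw [Real.exp_le_exp]
      linarith
    have h3 := mul_le_mul_of_nonneg_right h2 h0.le
    rw [Real.exp_neg, ← one_div, div_div, div_le_iff₀ (by positivity)]
    linarith
  have hyc' : δ ≤ base.idealChord (h (σ y)) (h (σ c)) := by
    refine hspread _ _ (le_of_eq ?_)
    rw [idealChord_coe_coe]
    simp only [p, sub_self, norm_zero]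
    field_simp
    norm_num
  have hx' : δ ≤ base.idealChord (h (σ x)) (h (σ OnePoint.infty)) := by
    refine hspread _ _ ?_
    rw [idealChord_coe_infty]
    simp only [p]
    rw [div_le_div_iff₀ (by norm_num) (by positivity)]
    nlinarith [norm_nonneg (x - c)]
  -- The left factor is at least `δ * δ` and the right one at most `M * M`, whence the constant `M /
  -- δ` after square roots.
  have key := norm_sq_mul_idealChord (g'.symm base) x' y' c'
  rw [← hx, ← hy, ← hc, ← hinf, hback, hback, hback, hback] at key
  have k1 : δ * δ ≤ base.idealChord (h (σ y)) (h (σ c)) *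
      base.idealChord (h (σ x)) (h (σ OnePoint.infty)) :=
    mul_le_mul hyc' hx' hδ.le (hδ.le.trans hyc')
  have k2 : base.idealChord (h (σ x)) (h (σ c)) *
      base.idealChord (h (σ y)) (h (σ OnePoint.infty)) ≤ M * M := by
    refine (le_abs_self _).trans ?_
    rw [abs_mul]
    exact mul_le_mul (hM' _ _) (hM' _ _) (abs_nonneg _) hM0.le
  have k3 := mul_le_mul_of_nonneg_left k1 (sq_nonneg ‖x' - c'‖)
  have k4 := mul_le_mul_of_nonneg_left k2 (sq_nonneg ‖y' - c'‖)
  rw [div_mul_eq_mul_div, le_div_iff₀ hδ]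
  refine (sq_le_sq₀ (by positivity) (by positivity)).1 ?_
  nlinarith

end

/-! ### From quasisymmetry to disks -/

theorem mainTheorem9 (h : Sphere ≃ₜ Sphere) (hequiv : IsEquivariantHomeo h)
    (hinf : h OnePoint.infty = OnePoint.infty) :
    ∃ K : ℝ, ∀ Δ : Set ℂ, IsDisk Δ →
      ∃ D₁ D₂ : Set ℂ, IsDisk D₁ ∧ IsDisk D₂ ∧
        inSphere D₁ ⊆ h '' inSphere Δ ∧ h '' inSphere Δ ⊆ inSphere D₂ ∧
        Metric.diam D₂ / Metric.diam D₁ < K := by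
  obtain ⟨K, hK, hqs⟩ := hequiv.exists_quasisymmetric hinf
  have hfin (z : ℂ) : ∃ w : ℂ, h z = w := by
    obtain ⟨w, hw⟩ := OnePoint.ne_infty_iff_exists.1
      (fun e => OnePoint.coe_ne_infty z (h.injective (e.trans hinf.symm)))
    exact ⟨w, hw.symm⟩
  have hsurj (w : ℂ) : ∃ z : ℂ, h z = w := by
    have hne : h.symm w ≠ OnePoint.infty := fun e =>
      OnePoint.coe_ne_infty w (by rw [← h.apply_symm_apply (w : Sphere), e, hinf])
    obtain ⟨z, hz⟩ := OnePoint.ne_infty_iff_exists.1 hne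
    exact ⟨z, by rw [hz, h.apply_symm_apply]⟩
  choose f hf using hfin
  -- The diameter ratio below is exactly `K * K`; adding 1 makes the inequality strict.
  refine ⟨K * K + 1, fun Δ hΔ => ?_⟩
  obtain ⟨c, r, hr, hΔ⟩ := hΔ
  have hsub : Δ ⊆ Metric.closedBall c r := by
    rcases hΔ with rfl | rfl
    · exact Metric.ball_subset_closedBall
    · exact subset_rfl
  have hsup : ∀ z ∉ Δ, r ≤ ‖z - c‖ := by
    intro z hz
    rw [← dist_eq_norm]
    rcases hΔ with rfl | rfl
    · simpa using hz
    · exact (not_le.1 hz).le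
  have hpt : ‖(c + r) - c‖ = r := by simp [abs_of_pos hr]
  have hptne : c + (r : ℂ) ≠ c := by simpa using hr.ne'
  -- One boundary point of the disk sets the scale of the image: quasisymmetry compares every other
  -- point with it.
  set ρ := ‖f (c + r) - f c‖ with hρ
  have hρ0 : 0 < ρ := by
    refine norm_pos_iff.2 (sub_ne_zero.2 fun e => hptne ?_)
    have : h (c + r : ℂ) = h c := by rw [hf, hf, e]
    exact OnePoint.coe_injective (h.injective this)
  refine ⟨Metric.ball (f c) (ρ / K), Metric.closedBall (f c) (K * ρ),
    ⟨_, _, by positivity, Or.inl rfl⟩, ⟨_, _, by positivity, Or.inr rfl⟩, ?_, ?_, ?_⟩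
  · rintro _ ⟨w, hw, rfl⟩
    obtain ⟨z, hz⟩ := hsurj w
    refine ⟨z, ⟨z, ?_, rfl⟩, hz⟩
    by_contra hzΔ
    have hrz := hsup z hzΔ
    have hzc : z ≠ c := fun e => by
      rw [e, sub_self, norm_zero] at hrz
      linarith
    -- Points outside `Δ` are at least as far from `c` as `c + r`, so their images are at distance
    -- at least `ρ / K` from `f c`.
    have h1 := hqs _ _ _ _ _ _ (hf (c + r)) hz (hf c) hzc (hpt.le.trans hrz)
    rw [Metric.mem_ball, dist_eq_norm, lt_div_iff₀ hK] at hw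
    linarith
  · rintro _ ⟨_, ⟨z, hz, rfl⟩, rfl⟩
    refine ⟨f z, ?_, (hf z).symm⟩
    have hzr := hsub hz
    rw [Metric.mem_closedBall, dist_eq_norm] at hzr ⊢
    exact hqs _ _ _ _ _ _ (hf z) (hf (c + r)) (hf c) hptne (hzr.trans hpt.ge)
  · rw [Metric.diam_closedBall_eq _ (by positivity), Metric.diam_ball_eq _ (by positivity)]
    have : 2 * (K * ρ) / (2 * (ρ / K)) = K * K := by field_simp
    linarith
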